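/- Let $f:\mathbb R^d\to\mathbb R$ have a zero-mean Gaussian process prior with covariance function $k$ (symmetric, positive semidefinite). Let $x_1,\dots,x_N\in\mathbb R^d$ be training inputs whose covariance matrix $K=(k(x_j,x_l))_{j,l}$ is positive definite, let $y_1,\dots,y_N\in\mathbb R$ be the outputs, and let the likelihood be factorized, $\prod_{j}p(y_j\mid f_j)$ with $f_j=f(x_j)$, where $p(y\mid\cdot)\ge 0$ is measurable. Let the site functions be Gaussian up to scale, $t_j(f_j)\propto \exp(\nu_jf_j-\tau_jf_j^2/2)$ with $\tau_j,\nu_j\in\mathbb R$; for $\tau_j\neq 0$ the site variance is $\widetilde\sigma_j^2=\tau_j^{-1}$ and the site mean is $\widetilde\mu_j=\nu_j\tau_j^{-1}$. The approximate posterior proportional to $\mathcal N(\mathbf f\mid 0,K)\prod_jt_j(f_j)$ is $q(\mathbf f)=\mathcal N(\mathbf f\mid\Sigma\nu,\Sigma)$ with $\Sigma=(K^{-1}+\mathrm{diag}(\tau_1,\dots,\tau_N))^{-1}$. For a test input $x_*$, put $k_*=(k(x_*,x_j))_j$. The predictive variance $\sigma^2(f(x_*))$ is the variance of the predictive distribution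 $\int p(f_*\mid\mathbf f)\,q(\mathbf f)\,d\mathbf f$, where $p(f_*\mid\mathbf f)=\mathcal N\big(f_*\mid k_*^{\mathsf T}K^{-1}\mathbf f,\;k(x_*,x_*)-k_*^{\mathsf T}K^{-1}k_*\big)$ is the conditional prior of $f_*=f(x_*)$. (If all $\tau_j\ne0$ it equals $k(x_*,x_*)-k_*^{\mathsf T}(K+\widetilde\Sigma)^{-1}k_*$ with $\widetilde\Sigma=\mathrm{diag}(\widetilde\sigma_1^2,\dots,\widetilde\sigma_N^2)$.) Fix current sites and an index $i$. Assume that the cavity distribution $q^{\setminus i}(\mathbf f)\propto\mathcal N(\mathbf f\mid 0,K)\prod_{j\ne i}t_j(f_j)$ is a proper Gaussian, that is, its precision matrix is positive definite (as is the case when $\tau_j\ge 0$ for all $j\neq i$). Let $q^{\setminus i}(f_i)=\mathcal N(\mu_{\setminus i},\sigma_{\setminus i}^2)$ be its $i$-th marginal, and let $\widetilde q(f_i)\propto q^{\setminus i}(f_i)\,p(y_i\mid f_i)$ be the tilted distribution, with normalizer in $(0,\infty)$. An EP projection of $\widetilde q$ is a Gaussian minimizing $\mathrm{KL}(\widetilde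 q\,\|\,\mathcal N)$, and a QP projection is a Gaussian minimizing the squared $L_2$ Wasserstein distance $W_2^2(\widetilde q,\mathcal N)$, both over Gaussians of positive variance and with finite minimum. Given a projection $\mathcal N(\mu^\star,\sigma^{\star2})$, the site $t_i$ is updated to $t_i(f_i)\propto\mathcal N(f_i\mid\mu^\star,\sigma^{\star2})/q^{\setminus i}(f_i)$, that is, $\tau_i=\sigma^{\star-2}-\sigma_{\setminus i}^{-2}$ and $\nu_i=\mu^\star\sigma^{\star-2}-\mu_{\setminus i}\sigma_{\setminus i}^{-2}$, and all other sites are kept. Then for every test input $x_*\in\mathbb R^d$ the predictive variances after updating site $i$ with a QP projection and with an EP projection of the same tilted distribution satisfy $$\sigma^2_{\mathrm{QP}}(f(x_*))\le\sigma^2_{\mathrm{EP}}(f(x_*)).$$ -/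

import Mathlib

open MeasureTheory ProbabilityTheory InformationTheory Matrix
open scoped ENNReal NNReal

noncomputable section

/-! ### The model -/

/-- A Gaussian process model with a factorized likelihood: a zero-mean prior with covariance
function `kernel` on `ℝᵈ`, training data `(input j, output j)` for `j : Fin N`, and the likelihood
`p(y | f) = ∏ j, likelihood (y j) (f j)`. -/
structure GPModel (d N : ℕ) where
  /-- The covariance function `k(x, x')` of the prior. -/
  kernel : EuclideanSpace ℝ (Fin d) → EuclideanSpace ℝ (Fin d) → ℝ
  /-- The training inputs `x_j`. -/
  input : Fin N → EuclideanSpace ℝ (Fin d)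
  /-- The training outputs `y_j`. -/
  output : Fin N → ℝ
  /-- `likelihood y f` is `p(y | f)`. -/
  likelihood : ℝ → ℝ → ℝ

/-- A Gaussian site function, up to its scale, in natural parameters:
`t(f) ∝ exp (shift * f - precision * f ^ 2 / 2)`.
The site `t(f) ∝ 𝒩(f | μ, σ²)` has `precision = σ⁻²` and `shift = μ σ⁻²`; a constant site
(infinite variance) has both parameters equal to `0`. -/
@[ext] structure GaussianSite where
  /-- The inverse of the site variance. -/
  precision : ℝ
  /-- The site mean divided by the site variance. -/
  shift : ℝ

/-- The constant site function. -/
def GaussianSite.flat : GaussianSite := ⟨0, 0⟩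

namespace GPModel

variable {d N : ℕ} (M : GPModel d N)

/-- The prior covariance matrix `K` of the latent values at the training inputs. -/
def gram : Matrix (Fin N) (Fin N) ℝ :=
  Matrix.of fun j l => M.kernel (M.input j) (M.input l)

/-- The vector `k_*` of prior covariances between a test input and the training inputs. -/
def crossCov (xstar : EuclideanSpace ℝ (Fin d)) : Fin N → ℝ :=
  fun j => M.kernel xstar (M.input j)

/-! ### The approximate posterior -/

/-- The precision matrix `K⁻¹ + diag(σ_j⁻²)` of the density proportional to
`p(f) * ∏ j, t_j(f_j)`. -/
def postPrecision (s : Fin N → GaussianSite) : Matrix (Fin N) (Fin N) ℝ :=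
  M.gram⁻¹ + Matrix.diagonal fun j => (s j).precision

/-- The covariance matrix `Σ = (K⁻¹ + diag(σ_j⁻²))⁻¹` of the approximate posterior. -/
def postCov (s : Fin N → GaussianSite) : Matrix (Fin N) (Fin N) ℝ :=
  (M.postPrecision s)⁻¹

/-- The mean `Σ (μ_j σ_j⁻²)_j` of the approximate posterior. -/
def postMean (s : Fin N → GaussianSite) : EuclideanSpace ℝ (Fin N) :=
  WithLp.toLp 2 (M.postCov s *ᵥ fun j => (s j).shift)

/-- The approximate posterior `q(f) ∝ p(f) * ∏ j, t_j(f_j)`, a Gaussian. -/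
def approxPosterior (s : Fin N → GaussianSite) : Measure (EuclideanSpace ℝ (Fin N)) :=
  multivariateGaussian (M.postMean s) (M.postCov s)

/-- The approximate predictive distribution `q(f_*) = ∫ p(f_* | f) q(f) df` of the latent value
`f_*` at the test input, where
`p(f_* | f) = 𝒩(k_*ᵀ K⁻¹ f, k(x_*, x_*) - k_*ᵀ K⁻¹ k_*)` is the conditional prior. -/
def predictive (s : Fin N → GaussianSite) (xstar : EuclideanSpace ℝ (Fin d)) : Measure ℝ :=
  (M.approxPosterior s).bind fun f =>
    gaussianReal (M.crossCov xstar ⬝ᵥ (M.gram⁻¹ *ᵥ f.ofLp))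
      (M.kernel xstar xstar - M.crossCov xstar ⬝ᵥ (M.gram⁻¹ *ᵥ M.crossCov xstar)).toNNReal

/-- The predictive variance `σ²(f(x_*))`. -/
def predictiveVariance (s : Fin N → GaussianSite) (xstar : EuclideanSpace ℝ (Fin d)) : ℝ :=
  variance id (M.predictive s xstar)

/-! ### Cavity and tilted distributions -/

/-- The sites with the `i`-th one removed, so that `p(f) * ∏ j, t_j(f_j)` for these sites is
`p(f) * ∏ j ≠ i, t_j(f_j)`, the unnormalized cavity density `q(f) / t_i(f_i)`. -/
def cavitySites (s : Fin N → GaussianSite) (i : Fin N) : Fin N → GaussianSite :=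
  Function.update s i GaussianSite.flat

/-- The mean of the marginal cavity distribution of `f_i`. -/
def cavityMean (s : Fin N → GaussianSite) (i : Fin N) : ℝ :=
  M.postMean (cavitySites s i) i

/-- The variance of the marginal cavity distribution of `f_i`. -/
def cavityVar (s : Fin N → GaussianSite) (i : Fin N) : ℝ≥0 :=
  (M.postCov (cavitySites s i) i i).toNNReal

/-- The marginal cavity distribution of `f_i`. -/
def cavity (s : Fin N → GaussianSite) (i : Fin N) : Measure ℝ :=
  gaussianReal (M.cavityMean s i) (M.cavityVar s i)

/-- The normalizer of the tilted distribution. -/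
def tiltedMass (s : Fin N → GaussianSite) (i : Fin N) : ℝ≥0∞ :=
  ∫⁻ f, ENNReal.ofReal (M.likelihood (M.output i) f) ∂(M.cavity s i)

/-- The marginal tilted distribution of `f_i`, proportional to the cavity distribution times
`p(y_i | f_i)`. -/
def tilted (s : Fin N → GaussianSite) (i : Fin N) : Measure ℝ :=
  (M.tiltedMass s i)⁻¹ •
    (M.cavity s i).withDensity fun f => ENNReal.ofReal (M.likelihood (M.output i) f)

/-- The sites after the local update of the `i`-th one: if `𝒩(m, v)` is the projection of the
tilted distribution, then the new site is `t_i(f_i) ∝ 𝒩(f_i | m, v) / cavity density(f_i)`. -/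
def updateSite (s : Fin N → GaussianSite) (i : Fin N) (m : ℝ) (v : ℝ≥0) : Fin N → GaussianSite :=
  Function.update s i
    { precision := (v : ℝ)⁻¹ - (M.cavityVar s i : ℝ)⁻¹
      shift := m * (v : ℝ)⁻¹ - M.cavityMean s i * (M.cavityVar s i : ℝ)⁻¹ }

end GPModel

/-! ### Projections onto the Gaussian family -/

/-- The squared `L₂` Wasserstein distance between two measures on the real line, as the infimum of
the transport cost over all couplings. -/
def wassersteinSq (ξ ν : Measure ℝ) : ℝ≥0∞ :=
  ⨅ (π : Measure (ℝ × ℝ)) (_ : π.map Prod.fst = ξ ∧ π.map Prod.snd = ν),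
    ∫⁻ z, ‖z.1 - z.2‖ₑ ^ 2 ∂π

/-- `𝒩(m, v)` is a projection of `q` onto the nondegenerate Gaussians with respect to the
divergence `D`: it minimizes `D q ·` among them, with a finite minimum. -/
def IsGaussianProjection (D : Measure ℝ → Measure ℝ → ℝ≥0∞) (q : Measure ℝ) (m : ℝ) (v : ℝ≥0) :
    Prop :=
  0 < v ∧ D q (gaussianReal m v) ≠ ∞ ∧
    ∀ (m' : ℝ) (v' : ℝ≥0), 0 < v' → D q (gaussianReal m v) ≤ D q (gaussianReal m' v')

/-- The projection of expectation propagation: `𝒩(m, v)` minimizes `KL(q ‖ 𝒩)`. -/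
def IsEPProjection (q : Measure ℝ) (m : ℝ) (v : ℝ≥0) : Prop :=
  IsGaussianProjection klDiv q m v

/-- The projection of quantile propagation: `𝒩(m, v)` minimizes `W₂²(q, 𝒩)`. -/
def IsQPProjection (q : Measure ℝ) (m : ℝ) (v : ℝ≥0) : Prop :=
  IsGaussianProjection wassersteinSq q m v

end

/-! With `a = K⁻¹ k_*`, the predictive variance is `aᵀ Σ a` plus a term independent of the sites.
Projecting to variance `v` adds `v⁻¹ - σ_cav⁻²` to the `(i, i)` entry of the cavity precision matrix
and changes nothing else. A smaller `v` thus gives a larger precision matrix and a smaller `Σ` in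
the Loewner order (`predictiveVariance_updateSite_mono`), and the claim reduces to `vQP ≤ vEP`.

The KL projection matches moments, so `vEP` is the variance of the tilted law `q`
(`IsEPProjection.var_eq`). A Gaussian with variance above `Var q` is not Wasserstein-optimal:
contracting it about its mean to variance `Var q` makes every coupling with `q` cheaper by at least
a fixed positive amount, by Cauchy–Schwarz for the covariance (`IsQPProjection.var_le`). No optimal
coupling or quantile formula is needed. -/

/-! ### Quadratic forms of positive definite matrices -/

section PosDef

variable {n : Type*} [Fintype n]

theorem Matrix.IsHermitian.dotProduct_mulVec_comm_real {A : Matrix n n ℝ} (hA : A.IsHermitian)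
    (x y : n → ℝ) : x ⬝ᵥ A *ᵥ y = y ⬝ᵥ A *ᵥ x := by
  have hA' : Aᵀ = A := by simpa [IsHermitian, conjTranspose_eq_transpose_of_trivial] using hA
  rw [dotProduct_mulVec, ← mulVec_transpose, hA', dotProduct_comm]

variable [DecidableEq n]

theorem Matrix.PosDef.mulVec_inv_mulVec {A : Matrix n n ℝ} (hA : A.PosDef) (x : n → ℝ) :
    A *ᵥ (A⁻¹ *ᵥ x) = x := by
  rw [mulVec_mulVec, mul_nonsing_inv _ ((isUnit_iff_isUnit_det A).1 hA.isUnit), one_mulVec]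

/-- The inverse reverses the Loewner order on positive definite matrices. -/
theorem Matrix.PosDef.dotProduct_inv_mulVec_anti {A B : Matrix n n ℝ} (hA : A.PosDef)
    (hB : B.PosDef) (hAB : ∀ x, x ⬝ᵥ A *ᵥ x ≤ x ⬝ᵥ B *ᵥ x) (a : n → ℝ) :
    a ⬝ᵥ B⁻¹ *ᵥ a ≤ a ⬝ᵥ A⁻¹ *ᵥ a := by
  -- With `u = B⁻¹ a` this expands to `0 ≤ uᵀAu - 2 aᵀu + aᵀA⁻¹a`, while `uᵀAu ≤ uᵀBu = aᵀu`.
  have hnonneg := hA.posSemidef.dotProduct_mulVec_nonneg (B⁻¹ *ᵥ a - A⁻¹ *ᵥ a)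
  have hcomm := hA.isHermitian.dotProduct_mulVec_comm_real (A⁻¹ *ᵥ a) (B⁻¹ *ᵥ a)
  have hle := hAB (B⁻¹ *ᵥ a)
  rw [hB.mulVec_inv_mulVec] at hle
  simp only [star_trivial, mulVec_sub, sub_dotProduct, dotProduct_sub,
    hA.mulVec_inv_mulVec] at hnonneg
  rw [hA.mulVec_inv_mulVec] at hcomm
  rw [hcomm] at hnonneg
  rw [dotProduct_comm a, dotProduct_comm a]
  linarith

/-- The Cauchy–Schwarz inequality for the `i`-th coordinate and the inner product given by a
positive definite matrix. -/
theorem Matrix.PosDef.sq_apply_le {A : Matrix n n ℝ} (hA : A.PosDef) (x : n → ℝ) (i : n) :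
    x i ^ 2 ≤ A⁻¹ i i * (x ⬝ᵥ A *ᵥ x) := by
  have hc : 0 < A⁻¹ i i := hA.inv.diag_pos
  -- `w` represents the `i`-th coordinate in the inner product of `A`: `xᵀAw = x i` and `wᵀAw = A⁻¹
  -- i i`.
  set w := A⁻¹ *ᵥ Pi.single i 1 with hw
  have hwi : w i = A⁻¹ i i := by simp [hw]
  have hAw : A *ᵥ w = Pi.single i 1 := hA.mulVec_inv_mulVec _
  have hcomm := hA.isHermitian.dotProduct_mulVec_comm_real w x
  have hnonneg := hA.posSemidef.dotProduct_mulVec_nonneg (A⁻¹ i i • x - x i • w)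
  simp only [star_trivial, mulVec_sub, sub_dotProduct, dotProduct_sub, mulVec_smul,
    smul_dotProduct, dotProduct_smul, hcomm, hAw, smul_eq_mul, dotProduct_single,
    mul_one, Pi.sub_apply, Pi.smul_apply, hwi] at hnonneg
  refine le_of_mul_le_mul_left ?_ hc
  linarith

theorem Matrix.dotProduct_diagonal_single_mulVec (x : n → ℝ) (i : n) (t : ℝ) :
    x ⬝ᵥ diagonal (Pi.single i t) *ᵥ x = t * x i ^ 2 := by
  rw [dotProduct, Finset.sum_eq_single i]
  · simp only [mulVec_diagonal, Pi.single_eq_same]; ring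
  · intro j _ hj; simp [mulVec_diagonal, hj]
  · simp

/-- Rank-one updates of the precision matrix: the `i`-th marginal variance of the Gaussian with
precision matrix `A` may be replaced by any positive number. -/
theorem Matrix.PosDef.add_diagonal_single {A : Matrix n n ℝ} (hA : A.PosDef) (i : n) {v : ℝ}
    (hv : 0 < v) : (A + diagonal (Pi.single i (v⁻¹ - (A⁻¹ i i)⁻¹))).PosDef := by
  have hc : 0 < A⁻¹ i i := hA.inv.diag_pos
  refine .of_dotProduct_mulVec_pos (hA.isHermitian.add (isHermitian_diagonal _)) fun x hx => ?_
  have hpos := hA.dotProduct_mulVec_pos hx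
  rw [star_trivial] at hpos ⊢
  rw [add_mulVec, dotProduct_add, dotProduct_diagonal_single_mulVec]
  -- Strict positivity comes from `A` when `x i = 0`, and otherwise from `v⁻¹ * x i ^ 2`, since the
  -- subtracted term is at most `xᵀAx`.
  rcases eq_or_ne (x i) 0 with h0 | h0
  · simpa [h0] using hpos
  · have h1 : (A⁻¹ i i)⁻¹ * x i ^ 2 ≤ x ⬝ᵥ A *ᵥ x := by
      rw [inv_mul_le_iff₀ hc]
      exact hA.sq_apply_le x i
    have h2 : 0 < v⁻¹ * x i ^ 2 := by positivity
    linarith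

end PosDef

/-! ### The predictive distribution -/

/-- Mixing the mean of a real Gaussian over a multivariate Gaussian along a linear functional
gives a Gaussian. -/
theorem multivariateGaussian_bind_gaussianReal {ι : Type*} [Fintype ι] [DecidableEq ι]
    (m : EuclideanSpace ℝ ι) {S : Matrix ι ι ℝ} (hS : S.PosSemidef) (a : ι → ℝ) (w : ℝ≥0) :
    ((multivariateGaussian m S).bind fun f => gaussianReal (a ⬝ᵥ f.ofLp) w) =
      gaussianReal (a ⬝ᵥ m.ofLp) ((a ⬝ᵥ S *ᵥ a).toNNReal + w) := by
  set μ := multivariateGaussian m S with hμ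
  let L : StrongDual ℝ (EuclideanSpace ℝ ι) := innerSL ℝ (WithLp.toLp 2 a)
  have hL (f : EuclideanSpace ℝ ι) : a ⬝ᵥ f.ofLp = L f := by
    simp [L, EuclideanSpace.inner_eq_star_dotProduct, dotProduct_comm]
  have hmean : μ[L] = L m := by
    rw [L.integral_comp_id_comm IsGaussian.integrable_id, hμ, integral_id_multivariateGaussian]
  have hvar : Var[L; μ] = a ⬝ᵥ S *ᵥ a := by
    have := covarianceBilin_self (μ := μ) IsGaussian.memLp_two_id (WithLp.toLp 2 a)
    rw [hμ, covarianceBilin_multivariateGaussian hS] at this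
    exact this.symm
  have hmap : μ.map L = gaussianReal (L m) (a ⬝ᵥ S *ᵥ a).toNNReal := by
    rw [IsGaussian.map_eq_gaussianReal, hmean, hvar]
  have hmeas : Measurable fun f : EuclideanSpace ℝ ι => gaussianReal (L f) w :=
    measurable_gaussianReal.comp (by fun_prop : Measurable fun f => (L f, w))
  -- The mixture is the law of a sum of independent variables, `L f` and centred noise of variance
  -- `w`.
  have hconv : gaussianReal (L m) ((a ⬝ᵥ S *ᵥ a).toNNReal + w) =
      (μ.map L).conv (gaussianReal 0 w) := by
    rw [hmap, gaussianReal_conv_gaussianReal, add_zero]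
  simp_rw [hL m, hconv, hL]
  ext s hs
  rw [Measure.bind_apply hs (by simpa using hmeas.aemeasurable), Measure.conv,
    Measure.map_apply measurable_add hs, Measure.prod_apply (measurable_add hs),
    lintegral_map (measurable_measure_prodMk_left (measurable_add hs)) (by fun_prop)]
  refine lintegral_congr fun f => ?_
  have := gaussianReal_map_const_add (μ := 0) (v := w) (L f)
  rw [zero_add] at this
  rw [← this, Measure.map_apply (by fun_prop) hs]
  rfl

namespace GPModel

variable {d N : ℕ} (M : GPModel d N)

/-- Law of total variance: the variance of the conditional mean plus the conditional variance. The
latter does not depend on `s`, so it cancels when two updates are compared. -/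
theorem predictiveVariance_eq (s : Fin N → GaussianSite) (hs : (M.postPrecision s).PosDef)
    (xstar : EuclideanSpace ℝ (Fin d)) :
    M.predictiveVariance s xstar =
      (M.crossCov xstar ᵥ* M.gram⁻¹) ⬝ᵥ (M.postPrecision s)⁻¹ *ᵥ (M.crossCov xstar ᵥ* M.gram⁻¹) +
      (M.kernel xstar xstar - M.crossCov xstar ⬝ᵥ (M.gram⁻¹ *ᵥ M.crossCov xstar)).toNNReal := by
  have hnonneg := hs.inv.posSemidef.dotProduct_mulVec_nonneg (M.crossCov xstar ᵥ* M.gram⁻¹)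
  rw [star_trivial] at hnonneg
  simp only [predictiveVariance, predictive, approxPosterior, postCov, dotProduct_mulVec _ M.gram⁻¹]
  rw [multivariateGaussian_bind_gaussianReal _ hs.inv.posSemidef, variance_id_gaussianReal,
    NNReal.coe_add, Real.coe_toNNReal _ hnonneg]

theorem postPrecision_updateSite (s : Fin N → GaussianSite) (i : Fin N) (m : ℝ) (v : ℝ≥0) :
    M.postPrecision (M.updateSite s i m v) =
      M.postPrecision (cavitySites s i) +
        diagonal (Pi.single i ((v : ℝ)⁻¹ - (M.cavityVar s i : ℝ)⁻¹)) := by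
  rw [postPrecision, postPrecision, add_assoc, diagonal_add]
  congr 2
  ext j
  rcases eq_or_ne j i with rfl | hj
  · simp [updateSite, cavitySites, GaussianSite.flat]
  · simp [updateSite, cavitySites, hj]

variable {M} {s : Fin N → GaussianSite} {i : Fin N}

theorem cavityVar_eq (hcavity : (M.postPrecision (cavitySites s i)).PosDef) :
    (M.cavityVar s i : ℝ) = (M.postPrecision (cavitySites s i))⁻¹ i i :=
  Real.coe_toNNReal _ hcavity.inv.diag_pos.le

theorem cavityVar_pos (hcavity : (M.postPrecision (cavitySites s i)).PosDef) :
    0 < M.cavityVar s i :=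
  Real.toNNReal_pos.2 hcavity.inv.diag_pos

/-- The new site precision may be negative, but the updated posterior remains a proper Gaussian. -/
theorem posDef_postPrecision_updateSite (hcavity : (M.postPrecision (cavitySites s i)).PosDef)
    (m : ℝ) {v : ℝ≥0} (hv : 0 < v) : (M.postPrecision (M.updateSite s i m v)).PosDef := by
  rw [postPrecision_updateSite, cavityVar_eq hcavity]
  exact hcavity.add_diagonal_single i hv

/-- The predictive variance after an update increases with the variance of the projection. -/
theorem predictiveVariance_updateSite_mono
    (hcavity : (M.postPrecision (cavitySites s i)).PosDef) {m₁ m₂ : ℝ} {v₁ v₂ : ℝ≥0}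
    (hv₁ : 0 < v₁) (hv : v₁ ≤ v₂) (xstar : EuclideanSpace ℝ (Fin d)) :
    M.predictiveVariance (M.updateSite s i m₁ v₁) xstar ≤
      M.predictiveVariance (M.updateSite s i m₂ v₂) xstar := by
  have h₁ := posDef_postPrecision_updateSite hcavity m₁ hv₁
  have h₂ := posDef_postPrecision_updateSite hcavity m₂ (hv₁.trans_le hv)
  rw [M.predictiveVariance_eq _ h₁, M.predictiveVariance_eq _ h₂, add_le_add_iff_right]
  refine h₂.dotProduct_inv_mulVec_anti h₁ (fun x => ?_) _
  have : (v₂ : ℝ)⁻¹ ≤ (v₁ : ℝ)⁻¹ := inv_anti₀ hv₁ hv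
  simp only [postPrecision_updateSite, add_mulVec, dotProduct_add, add_le_add_iff_left,
    dotProduct_diagonal_single_mulVec]
  gcongr

end GPModel

/-! ### Second moments -/

section Moments

variable {Ω : Type*} [MeasurableSpace Ω] {P : Measure Ω}

theorem ProbabilityTheory.integral_sq_eq_variance_add [IsProbabilityMeasure P] {X : Ω → ℝ}
    (hX : MemLp X 2 P) : ∫ ω, X ω ^ 2 ∂P = Var[X; P] + (∫ ω, X ω ∂P) ^ 2 := by
  rw [variance_eq_sub hX]
  simp

theorem MeasureTheory.lintegral_enorm_sq_eq_ofReal {X : Ω → ℝ} (hX : MemLp X 2 P) :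
    ∫⁻ ω, ‖X ω‖ₑ ^ 2 ∂P = ENNReal.ofReal (∫ ω, X ω ^ 2 ∂P) := by
  rw [ofReal_integral_eq_lintegral_ofReal hX.integrable_sq (ae_of_all _ fun _ => sq_nonneg _)]
  refine lintegral_congr fun ω => ?_
  rw [← enorm_pow, Real.enorm_of_nonneg (sq_nonneg _)]

theorem MeasureTheory.memLp_two_of_lintegral_enorm_sq_ne_top {X : Ω → ℝ}
    (hX : AEStronglyMeasurable X P) (h : ∫⁻ ω, ‖X ω‖ₑ ^ 2 ∂P ≠ ∞) : MemLp X 2 P := by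
  refine ⟨hX, ?_⟩
  rw [eLpNorm_lt_top_iff_lintegral_rpow_enorm_lt_top (by simp) (by simp)]
  simpa using h.lt_top

/-- A real probability measure without atoms has positive variance. -/
theorem ProbabilityTheory.variance_id_pos {q : Measure ℝ} [IsProbabilityMeasure q]
    [NullSingletonClass q] (hq : MemLp id 2 q) : 0 < Var[id; q] := by
  refine (variance_nonneg _ _).lt_of_ne' fun h => ?_
  have hae := ae_eq_integral_of_variance_eq_zero hq h
  have hne : ∀ᵐ x ∂q, x ≠ ∫ y, id y ∂q := by simp [ae_iff]
  obtain ⟨x, hx, hx'⟩ := (hae.and hne).exists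
  exact hx' hx

end Moments

/-! ### Projection in the Kullback–Leibler divergence -/

section KL

theorem ProbabilityTheory.log_gaussianPDFReal (m : ℝ) {v : ℝ≥0} (hv : 0 < v) (x : ℝ) :
    Real.log (gaussianPDFReal m v x) =
      -(Real.log (2 * Real.pi) + Real.log v) / 2 - (x - m) ^ 2 / (2 * v) := by
  have hv' : (0 : ℝ) < v := hv
  rw [gaussianPDFReal, Real.log_mul (by positivity) (Real.exp_ne_zero _), Real.log_exp,
    Real.log_inv, Real.log_sqrt (by positivity), Real.log_mul (by positivity) hv'.ne']
  ring

variable {q : Measure ℝ} [IsProbabilityMeasure q]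

/-- Isolates a term independent of `m` and `v`. It cancels when two Gaussians are compared, so the
entropy of `q` need not be finite. -/
theorem llr_gaussianReal_ae_eq (m : ℝ) {v : ℝ≥0} (hv : 0 < v) (hq : q ≪ gaussianReal m v) :
    llr q (gaussianReal m v) =ᵐ[q] fun x =>
      Real.log (q.rnDeriv volume x).toReal - Real.log (gaussianPDFReal m v x) := by
  have hac := gaussianReal_absolutelyContinuous m hv.ne'
  filter_upwards [hq (Measure.rnDeriv_mul_rnDeriv' (μ := q) hac),
    hq (hac (rnDeriv_gaussianReal m v)), Measure.rnDeriv_pos hq,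
    hq (Measure.rnDeriv_lt_top q (gaussianReal m v))] with x h₁ h₂ h₃ h₄
  rw [← h₁, Pi.mul_apply, h₂, ENNReal.toReal_mul, toReal_gaussianPDF,
    Real.log_mul (ENNReal.toReal_pos h₃.ne' h₄.ne).ne' (gaussianPDFReal_pos _ _ _ hv.ne').ne',
    add_sub_cancel_right, llr]

theorem integral_log_gaussianPDFReal (hsq : MemLp id 2 q) (m : ℝ) {v : ℝ≥0} (hv : 0 < v) :
    Integrable (fun x => Real.log (gaussianPDFReal m v x)) q ∧
    ∫ x, Real.log (gaussianPDFReal m v x) ∂q =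
      -(Real.log (2 * Real.pi) + Real.log v) / 2 -
        (Var[id; q] + ((∫ x, x ∂q) - m) ^ 2) / (2 * v) := by
  have hX : MemLp (fun x => x - m) 2 q := hsq.sub (memLp_const m)
  have hint : Integrable (fun x => (x - m) ^ 2 / (2 * (v : ℝ))) q :=
    hX.integrable_sq.div_const _
  have hmean : ∫ x, (x - m) ∂q = (∫ x, x ∂q) - m := by
    simpa using integral_sub (hsq.integrable one_le_two) (integrable_const m)
  have hvar : Var[fun x => x - m; q] = Var[id; q] :=
    variance_sub_const (X := id) aestronglyMeasurable_id m
  simp only [log_gaussianPDFReal m hv]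
  refine ⟨(integrable_const _).sub hint, ?_⟩
  rw [integral_sub (integrable_const _) hint, integral_div (2 * (v : ℝ)),
    integral_sq_eq_variance_add hX, hmean, hvar]
  simp

/-- The variance of the Gaussian minimizing `KL(q ‖ ·)` is the variance of `q`. -/
theorem IsEPProjection.var_eq (hsq : MemLp id 2 q) (hpos : 0 < Var[id; q]) {m : ℝ} {v : ℝ≥0}
    (h : IsEPProjection q m v) : (v : ℝ) = Var[id; q] := by
  obtain ⟨hv, hfin, hmin⟩ := h
  obtain ⟨hac, hint⟩ := klDiv_ne_top_iff.1 hfin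
  set μ := ∫ x, x ∂q
  -- The competitor is the Gaussian with the mean and variance of `q`.
  set V : ℝ≥0 := Var[id; q].toNNReal
  have hV : (V : ℝ) = Var[id; q] := Real.coe_toNNReal _ hpos.le
  have hV0 : 0 < V := Real.toNNReal_pos.2 hpos
  have hac' : q ≪ gaussianReal μ V :=
    hac.trans ((gaussianReal_absolutelyContinuous m hv.ne').trans
      (gaussianReal_absolutelyContinuous' μ hV0.ne'))
  obtain ⟨hi, he⟩ := integral_log_gaussianPDFReal hsq m hv
  obtain ⟨hi', he'⟩ := integral_log_gaussianPDFReal hsq μ hV0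
  have hllr : llr q (gaussianReal μ V) =ᵐ[q] fun x => llr q (gaussianReal m v) x +
      (Real.log (gaussianPDFReal m v x) - Real.log (gaussianPDFReal μ V x)) := by
    filter_upwards [llr_gaussianReal_ae_eq m hv hac, llr_gaussianReal_ae_eq μ hV0 hac']
      with x h₁ h₂
    rw [h₁, h₂]; ring
  have hint' : Integrable (llr q (gaussianReal μ V)) q :=
    (hint.add (hi.sub hi')).congr hllr.symm
  have hsplit := integral_add hint (hi.sub hi')
  simp only [Pi.sub_apply] at hsplit
  rw [integral_sub hi hi'] at hsplit
  have hle := ENNReal.toReal_mono (klDiv_ne_top hac' hint') (hmin μ V hV0)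
  rw [toReal_klDiv_of_measure_eq hac (by simp), toReal_klDiv_of_measure_eq hac' (by simp),
    integral_congr_ae hllr, hsplit, he, he',
    ← hV] at hle
  have hv' : (0 : ℝ) < v := hv
  have hV' : (0 : ℝ) < V := hV0
  rw [← hV]
  by_contra hne
  -- Minimality yields `V / v - 1 + (μ - m)² / v ≤ log (V / v)`, which the strict logarithm
  -- inequality excludes unless `V = v`.
  have hlog := Real.log_lt_sub_one_of_pos (div_pos hV' hv')
    (fun h => hne ((div_eq_one_iff_eq hv'.ne').1 h).symm)
  rw [Real.log_div hV'.ne' hv'.ne'] at hlog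
  have h₁ : ((V : ℝ) + (μ - m) ^ 2) / (2 * v) = (V / v) / 2 + (μ - m) ^ 2 / (2 * v) := by
    field_simp
  have h₂ : ((V : ℝ) + (μ - μ) ^ 2) / (2 * V) = 1 / 2 := by
    field_simp; ring
  have h₃ : 0 ≤ (μ - m) ^ 2 / (2 * (v : ℝ)) := by positivity
  rw [h₁, h₂] at hle
  linarith

end KL

/-! ### Projection in the Wasserstein distance -/

section Wasserstein

variable {q ν : Measure ℝ} {π : Measure (ℝ × ℝ)}

theorem wassersteinSq_le (h₁ : π.map Prod.fst = q) (h₂ : π.map Prod.snd = ν) :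
    wassersteinSq q ν ≤ ∫⁻ z, ‖z.1 - z.2‖ₑ ^ 2 ∂π :=
  iInf₂_le π ⟨h₁, h₂⟩

/-- Some coupling has finite cost, and `x = (x - y) + y`. This supplies the second moment of the
tilted law, which is not assumed. -/
theorem memLp_two_of_wassersteinSq_ne_top (hν : MemLp id 2 ν) (h : wassersteinSq q ν ≠ ∞) :
    MemLp id 2 q := by
  simp only [wassersteinSq, ne_eq, iInf_eq_top, not_forall] at h
  obtain ⟨π, ⟨h₁, h₂⟩, hπ⟩ := h
  have hsnd : MemLp (Prod.snd : ℝ × ℝ → ℝ) 2 π := by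
    rw [← h₂] at hν
    exact (memLp_map_measure_iff aestronglyMeasurable_id measurable_snd.aemeasurable).1 hν
  have hsub : MemLp (fun z : ℝ × ℝ => z.1 - z.2) 2 π :=
    memLp_two_of_lintegral_enorm_sq_ne_top (by fun_prop) hπ
  rw [← h₁, memLp_map_measure_iff aestronglyMeasurable_id measurable_fst.aemeasurable]
  exact (hsub.add hsnd).ae_eq (ae_of_all _ fun z => by simp)

variable [IsProbabilityMeasure q]

theorem isProbabilityMeasure_of_map_fst (h : π.map Prod.fst = q) : IsProbabilityMeasure π := by
  have : IsProbabilityMeasure (π.map Prod.fst) := h ▸ inferInstance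
  exact Measure.isProbabilityMeasure_of_map Prod.fst

/-- The transport cost of a coupling in terms of means, variances and covariance. -/
theorem lintegral_enorm_sub_sq_coupling (hq : MemLp id 2 q) (hν : MemLp id 2 ν)
    (h₁ : π.map Prod.fst = q) (h₂ : π.map Prod.snd = ν) :
    ∫⁻ z, ‖z.1 - z.2‖ₑ ^ 2 ∂π = ENNReal.ofReal (Var[id; q] -
      2 * cov[Prod.fst, Prod.snd; π] + Var[id; ν] + ((∫ x, x ∂q) - ∫ x, x ∂ν) ^ 2) := by
  have := isProbabilityMeasure_of_map_fst h₁
  subst h₁ h₂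
  have hfst : MemLp (Prod.fst : ℝ × ℝ → ℝ) 2 π :=
    (memLp_map_measure_iff aestronglyMeasurable_id measurable_fst.aemeasurable).1 hq
  have hsnd : MemLp (Prod.snd : ℝ × ℝ → ℝ) 2 π :=
    (memLp_map_measure_iff aestronglyMeasurable_id measurable_snd.aemeasurable).1 hν
  have hsub : MemLp (fun z : ℝ × ℝ => z.1 - z.2) 2 π := hfst.sub hsnd
  rw [lintegral_enorm_sq_eq_ofReal hsub, integral_sq_eq_variance_add hsub,
    variance_fun_sub hfst hsnd,
    integral_sub (hfst.integrable one_le_two) (hsnd.integrable one_le_two),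
    variance_map aemeasurable_id measurable_fst.aemeasurable,
    variance_map aemeasurable_id measurable_snd.aemeasurable,
    integral_map measurable_fst.aemeasurable (by fun_prop),
    integral_map measurable_snd.aemeasurable (by fun_prop)]
  rfl

/-- Cauchy–Schwarz, with `r` the ratio of standard deviations: expand `0 ≤ Var (X - r Y)` for a
coupled pair `(X, Y)`. -/
theorem covariance_coupling_le (hq : MemLp id 2 q) (hν : MemLp id 2 ν)
    (h₁ : π.map Prod.fst = q) (h₂ : π.map Prod.snd = ν) {r : ℝ} (hr : 0 < r)
    (hvar : Var[id; q] = r ^ 2 * Var[id; ν]) :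
    cov[Prod.fst, Prod.snd; π] ≤ r * Var[id; ν] := by
  have := isProbabilityMeasure_of_map_fst h₁
  subst h₁ h₂
  have hfst : MemLp (Prod.fst : ℝ × ℝ → ℝ) 2 π :=
    (memLp_map_measure_iff aestronglyMeasurable_id measurable_fst.aemeasurable).1 hq
  have hsnd : MemLp (Prod.snd : ℝ × ℝ → ℝ) 2 π :=
    (memLp_map_measure_iff aestronglyMeasurable_id measurable_snd.aemeasurable).1 hν
  have hnonneg := variance_nonneg (fun z : ℝ × ℝ => z.1 - r * z.2) π
  rw [variance_fun_sub hfst (hsnd.const_mul r), variance_const_mul,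
    covariance_const_mul_right] at hnonneg
  rw [variance_map aemeasurable_id measurable_fst.aemeasurable,
    variance_map aemeasurable_id measurable_snd.aemeasurable] at hvar
  rw [variance_map aemeasurable_id measurable_snd.aemeasurable]
  simp only [Function.id_comp] at hvar ⊢
  refine le_of_mul_le_mul_left ?_ hr
  linarith

/-- The variance of the Gaussian minimizing the Wasserstein distance to `q` is at most the variance
of `q`. -/
theorem IsQPProjection.var_le (hpos : 0 < Var[id; q]) {m : ℝ} {v : ℝ≥0}
    (h : IsQPProjection q m v) : (v : ℝ) ≤ Var[id; q] := by
  obtain ⟨hv, hfin, hmin⟩ := h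
  have hv' : (0 : ℝ) < v := hv
  have hN (v' : ℝ≥0) : MemLp id 2 (gaussianReal m v') := memLp_id_gaussianReal 2
  have hq := memLp_two_of_wassersteinSq_ne_top (hN v) hfin
  by_contra! hlt
  set r : ℝ := √(Var[id; q] / v)
  have hr0 : 0 < r := Real.sqrt_pos.2 (div_pos hpos hv')
  have hr2 : r ^ 2 = Var[id; q] / v := Real.sq_sqrt (div_pos hpos hv').le
  have hr1 : r < 1 := by
    have : r ^ 2 < 1 := by rwa [hr2, div_lt_one hv']
    nlinarith
  have hvar : Var[id; q] = r ^ 2 * v := by rw [hr2]; field_simp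
  set V : ℝ≥0 := ⟨r ^ 2, sq_nonneg r⟩ * v
  have hVr : (V : ℝ) = r ^ 2 * v := rfl
  have hV0 : 0 < V := by
    rw [← NNReal.coe_pos, hVr]; positivity
  -- The gap is the same for every coupling, so it passes to the infimum.
  have hmain : wassersteinSq q (gaussianReal m V) + ENNReal.ofReal ((1 - r) ^ 2 * v) ≤
      wassersteinSq q (gaussianReal m v) := by
    refine le_iInf₂ fun π ⟨h₁, h₂⟩ => ?_
    -- Contracts the Gaussian coordinate about `m` by the factor `r`, keeping the first marginal and
    -- the mean.
    set T : ℝ × ℝ → ℝ × ℝ := fun z => (z.1, r * z.2 + (1 - r) * m)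
    have hTm : Measurable T := by fun_prop
    have hT₁ : (π.map T).map Prod.fst = q := by
      rw [Measure.map_map measurable_fst hTm, ← h₁]; rfl
    have hT₂ : (π.map T).map Prod.snd = gaussianReal m V := by
      have : Prod.snd ∘ T = (fun y => y + (1 - r) * m) ∘ (fun y => r * y) ∘ Prod.snd := rfl
      rw [Measure.map_map measurable_snd hTm, this,
        ← Measure.map_map (by fun_prop) (by fun_prop),
        ← Measure.map_map (by fun_prop) (by fun_prop), h₂, gaussianReal_map_const_mul,
        gaussianReal_map_add_const]
      congr 1
      ring
    have := isProbabilityMeasure_of_map_fst h₁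
    have hsnd : MemLp (Prod.snd : ℝ × ℝ → ℝ) 2 π := by
      have := hN v
      rw [← h₂] at this
      exact (memLp_map_measure_iff aestronglyMeasurable_id measurable_snd.aemeasurable).1 this
    have hcov : cov[Prod.fst, Prod.snd; π.map T] = r * cov[Prod.fst, Prod.snd; π] := by
      rw [covariance_map (by fun_prop) (by fun_prop) hTm.aemeasurable,
        ← covariance_const_mul_right]
      exact covariance_add_const_right (Y := fun z : ℝ × ℝ => r * z.2)
        ((hsnd.const_mul r).integrable one_le_two) _
    have hcle := covariance_coupling_le hq (hN v) h₁ h₂ hr0 (by simpa using hvar)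
    have hcost := lintegral_enorm_sub_sq_coupling hq (hN V) hT₁ hT₂
    refine (add_le_add_left (wassersteinSq_le hT₁ hT₂) _).trans ?_
    rw [hcost, lintegral_enorm_sub_sq_coupling hq (hN v) h₁ h₂, hcov, ← ENNReal.ofReal_add]
    · refine ENNReal.ofReal_le_ofReal ?_
      simp only [variance_id_gaussianReal, integral_id_gaussianReal] at hcle ⊢
      rw [hVr]
      -- For covariance `c ≤ r v` the saving is `(1 - r²) v - 2 (1 - r) c ≥ (1 - r)² v`.
      nlinarith [mul_le_mul_of_nonneg_left hcle (sub_nonneg.2 hr1.le)]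
    · simp only [variance_id_gaussianReal, integral_id_gaussianReal] at hcle ⊢
      rw [hVr, hvar]
      nlinarith [mul_le_mul_of_nonneg_left hcle hr0.le, sq_nonneg (∫ x, x ∂q - m)]
    · positivity
  have hlt' : wassersteinSq q (gaussianReal m V) < wassersteinSq q (gaussianReal m v) := by
    have hgap : 0 < ENNReal.ofReal ((1 - r) ^ 2 * v) :=
      ENNReal.ofReal_pos.2 (mul_pos (pow_pos (sub_pos.2 hr1) 2) hv')
    have hVfin : wassersteinSq q (gaussianReal m V) ≠ ∞ :=
      ne_top_of_le_ne_top hfin (le_self_add.trans hmain)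
    exact (ENNReal.lt_add_right hVfin hgap.ne').trans_le hmain
  exact hlt'.not_ge (hmin m V hV0)

end Wasserstein

namespace GPModel

variable {d N : ℕ} (M : GPModel d N) (s : Fin N → GaussianSite) (i : Fin N)

theorem isProbabilityMeasure_tilted (hmass_pos : M.tiltedMass s i ≠ 0)
    (hmass_fin : M.tiltedMass s i ≠ ∞) : IsProbabilityMeasure (M.tilted s i) := by
  constructor
  rw [tilted, Measure.smul_apply, withDensity_apply _ .univ, Measure.restrict_univ, smul_eq_mul]
  exact ENNReal.inv_mul_cancel hmass_pos hmass_fin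

theorem tilted_absolutelyContinuous : M.tilted s i ≪ M.cavity s i :=
  (withDensity_absolutelyContinuous _ _).smul_left _

end GPModel

theorem corollary2 {d N : ℕ} (M : GPModel d N)
    (hkernel : (Matrix.of M.kernel).PosSemidef)
    (hgram : M.gram.PosDef)
    (hlik_nonneg : ∀ y f : ℝ, 0 ≤ M.likelihood y f)
    (hlik_meas : ∀ y : ℝ, Measurable (M.likelihood y))
    (s : Fin N → GaussianSite) (i : Fin N)
    (hcavity : (M.postPrecision (GPModel.cavitySites s i)).PosDef)
    (hmass_pos : M.tiltedMass s i ≠ 0) (hmass_fin : M.tiltedMass s i ≠ ∞)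
    (mEP mQP : ℝ) (vEP vQP : ℝ≥0)
    (hEP : IsEPProjection (M.tilted s i) mEP vEP)
    (hQP : IsQPProjection (M.tilted s i) mQP vQP)
    (xstar : EuclideanSpace ℝ (Fin d)) :
    M.predictiveVariance (M.updateSite s i mQP vQP) xstar ≤
      M.predictiveVariance (M.updateSite s i mEP vEP) xstar := by
  have := M.isProbabilityMeasure_tilted s i hmass_pos hmass_fin
  -- The tilted law inherits the absence of atoms from the nondegenerate cavity Gaussian, so its
  -- variance is positive.
  have : NullSingletonClass (M.tilted s i) := by
    refine ⟨fun x => ?_⟩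
    have := nullSingletonClass_gaussianReal (μ := M.cavityMean s i)
      (GPModel.cavityVar_pos hcavity).ne'
    exact M.tilted_absolutelyContinuous s i (this.measure_singleton x)
  have hsq : MemLp id 2 (M.tilted s i) :=
    memLp_two_of_wassersteinSq_ne_top (memLp_id_gaussianReal 2) hQP.2.1
  have hpos := variance_id_pos hsq
  refine GPModel.predictiveVariance_updateSite_mono hcavity hQP.1 ?_ xstar
  rw [← NNReal.coe_le_coe, hEP.var_eq hsq hpos]
  exact hQP.var_le hpos
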